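/- Setting. Let $(K,d)$ be a metric space in which every set of finite diameter is relatively compact. Let $(V,E,i,t)$ be a finite directed multigraph with vertex set $V=\{1,\dots,N\}$, edge set $E$, initial-vertex map $i:E\to V$ (assumed surjective) and terminal-vertex map $t:E\to V$. Let $K_1,\dots,K_N$ be a partition of $K$ into non-empty open sets, let $w_e:K\to K$ ($e\in E$) be Borel maps with $w_e(K_{i(e)})\subset K_{t(e)}$, and let $p_e:K\to[0,\infty)$ ($e\in E$) be Borel functions with $\sum_{e\in E}p_e=1$ and $p_e=0$ off $K_{i(e)}$. Assume that each $p_e|_{K_{i(e)}}$ is uniformly continuous and that $p_e|_{K_{i(e)}}\ge\delta$ for all $e$, for some $\delta>0$; and that for some $0<a<1$ $$\sum_{e\in E}p_e(x)\,d(w_ex,w_ey)\le a\,d(x,y)\qquad\text{for all }x,y\in K_j,\ j=1,\dots,N.$$ A Borel probability measure $\mu$ on $K$ is called invariant if $\int\sum_{e}p_e\cdot(f\circ w_e)\,d\mu=\int f\,d\mu$ for all bounded Borel functions $f$. Fix an invariant Borel probability measure $\mu$ and points $x_j\in K_j$, $j=1,\dots,N$. Let $\Sigma=E^{\mathbb Z}$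 with the product topology, let $S$ be the left shift, $(S\sigma)_j=\sigma_{j+1}$, and let the generalized Markov measure $M$ be the Borel probability measure on $\Sigma$ given by $$M(\{\sigma:\sigma_m=e_1,\dots,\sigma_{m+k-1}=e_k\})=\int p_{e_1}(x)\,p_{e_2}(w_{e_1}x)\cdots p_{e_k}(w_{e_{k-1}}\circ\cdots\circ w_{e_1}x)\,d\mu(x)$$ for all $m\in\mathbb Z$, $k\ge1$, $e_1,\dots,e_k\in E$. Let $\Sigma_G=\{\sigma\in\Sigma: t(\sigma_j)=i(\sigma_{j+1})\ \forall j\in\mathbb Z\}$. The coding map is $$F(\sigma)=\lim_{m\to-\infty}w_{\sigma_0}\circ w_{\sigma_{-1}}\circ\cdots\circ w_{\sigma_m}\,x_{i(\sigma_m)},$$ defined for those $\sigma$ for which the limit exists in $K$. Let $D$ be the set of all $\sigma\in\Sigma_G$ for which this limit exists, and $Y=\bigcap_{k\in\mathbb Z}S^k(D)$. A function $h:(X,d)\to\mathbb R$ is Dini-continuous if $\int_0^c\frac{\phi(t)}{t}\,dt<\infty$ for some $c>0$, where $\phi(t)=\sup\{|h(x)-h(y)|:x,y\in X,\ d(x,y)\le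 t\}$. Lemma. (i) $F(\sigma)$ is defined for all $\sigma\in Y$, and $Y$ is a shift-invariant subset of $\Sigma_G$, i.e. $Y\subset\Sigma_G$ and $S(Y)=Y$. (ii) If each $p_e|_{K_{i(e)}}$ is Dini-continuous, then $M(Y)=1$. (iii) If each $p_e|_{K_{i(e)}}$ is Dini-continuous and there is an invariant Borel probability measure $\nu$ on $K$ with $\nu(K_{i(e)})>0$ for all $e\in E$, then $Y$ is dense in $\Sigma_G$. -/

import Mathlib

open MeasureTheory Filter Topology
open scoped ENNReal

/-- A Markov system `(K_{i(e)}, w_e, p_e)_{e ∈ E}` on `K`: a directed multigraph with vertex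
set `V`, edge set `E`, initial and terminal vertex maps `i`, `t`; a partition of `K` into
non-empty Borel vertex sets; Borel maps `w e` with `w e (K_{i(e)}) ⊆ K_{t(e)}`; and Borel
probability functions `p e` vanishing off `K_{i(e)}`. -/
structure MarkovSystem (V E K : Type*) [Fintype E] [MeasurableSpace K] where
  i : E → V
  t : E → V
  /-- `part v` is the vertex set `K_v`. -/
  part : V → Set K
  part_nonempty : ∀ v, (part v).Nonempty
  part_measurable : ∀ v, MeasurableSet (part v)
  part_disjoint : ∀ v v', v ≠ v' → Disjoint (part v) (part v')
  part_cover : ⋃ v, part v = Set.univ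
  w : E → K → K
  w_measurable : ∀ e, Measurable (w e)
  w_mapsTo : ∀ e, Set.MapsTo (w e) (part (i e)) (part (t e))
  p : E → K → ℝ
  p_measurable : ∀ e, Measurable (p e)
  p_nonneg : ∀ e x, 0 ≤ p e x
  p_sum : ∀ x, ∑ e, p e x = 1
  p_zero : ∀ e x, x ∉ part (i e) → p e x = 0

/-- The modulus of uniform continuity `φ(t) = sup {|h x - h y| : d(x,y) ≤ t}`, with values in
`[0, ∞]`. -/
noncomputable def uniformModulus {X : Type*} [MetricSpace X] (h : X → ℝ) (t : ℝ) : ℝ≥0∞ :=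
  ⨆ (x : X) (y : X) (_ : dist x y ≤ t), ENNReal.ofReal |h x - h y|

/-- Dini-continuity: `∫₀ᶜ φ(t)/t dt < ∞` for some `c > 0`. -/
def DiniContinuous {X : Type*} [MetricSpace X] (h : X → ℝ) : Prop :=
  ∃ c : ℝ, 0 < c ∧ ∫⁻ s in Set.Ioo 0 c, uniformModulus h s / ENNReal.ofReal s < ∞

/-- The left shift `(Sσ)_j = σ_{j+1}` on the code space `Σ = E^ℤ`. -/
def leftShift (E : Type*) : Equiv.Perm (ℤ → E) where
  toFun σ j := σ (j + 1)
  invFun σ j := σ (j - 1)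
  left_inv σ := by funext j; simp
  right_inv σ := by funext j; simp

/-- The cylinder `ₘ[e₁,…,e_k] = {σ : σ_m = e₁, …, σ_{m+k-1} = e_k}`. -/
def codeCylinder {E : Type*} (m : ℤ) (l : List E) : Set (ℤ → E) :=
  {σ | ∀ (j : ℕ) (hj : j < l.length), σ (m + j) = l[j]}

namespace MarkovSystem

variable {V E K : Type*} [Fintype E]

section Measurable

variable [MeasurableSpace K] (𝓜 : MarkovSystem V E K)

/-- The Markov operator `U f = ∑ₑ pₑ · (f ∘ wₑ)`. -/
def markovOp (f : K → ℝ) (x : K) : ℝ := ∑ e, 𝓜.p e x * f (𝓜.w e x)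

/-- `U^* μ = μ`, i.e. `∫ U f dμ = ∫ f dμ` for every bounded Borel function `f`. -/
def IsInvariant (μ : Measure K) : Prop :=
  ∀ f : K → ℝ, Measurable f → (∃ C, ∀ x, |f x| ≤ C) → ∫ x, 𝓜.markovOp f x ∂μ = ∫ x, f x ∂μ

/-- `p_{e₁}(x) p_{e₂}(w_{e₁} x) ⋯ p_{e_k}(w_{e_{k-1}} ∘ ⋯ ∘ w_{e₁} x)`. -/
def pathProb : List E → K → ℝ
  | [], _ => 1
  | e :: l, x => 𝓜.p e x * pathProb l (𝓜.w e x)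

/-- `M` is a probability measure with the cylinder values of the generalized Markov measure
associated with `μ`. -/
structure IsGeneralizedMarkovMeasure [MeasurableSpace E] (μ : Measure K)
    (M : Measure (ℤ → E)) : Prop where
  isProbabilityMeasure : IsProbabilityMeasure M
  cylinder_eq : ∀ (m : ℤ) (l : List E),
    M (codeCylinder m l) = ∫⁻ x, ENNReal.ofReal (𝓜.pathProb l x) ∂μ

open Classical in
/-- The generalized Markov measure associated with `μ`: the probability measure on the code
space with the prescribed values on cylinders (at most one exists, since the cylinders determine
a probability measure on the product σ-algebra; the value `0` is taken if there is none, which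
does not happen when `μ` is an invariant probability measure). -/
noncomputable def generalizedMarkovMeasure [MeasurableSpace E] (μ : Measure K) :
    Measure (ℤ → E) :=
  if h : ∃ M, 𝓜.IsGeneralizedMarkovMeasure μ M then h.choose else 0

/-- `Σ_G = {σ : t(σ_j) = i(σ_{j+1}) for all j ∈ ℤ}`. -/
def pathSpace : Set (ℤ → E) := {σ | ∀ j : ℤ, 𝓜.t (σ j) = 𝓜.i (σ (j + 1))}

/-- `w_{σ_0} ∘ w_{σ_{-1}} ∘ ⋯ ∘ w_{σ_{-n}}`. -/
def backwardComp (σ : ℤ → E) : ℕ → K → K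
  | 0 => 𝓜.w (σ 0)
  | n + 1 => backwardComp σ n ∘ 𝓜.w (σ (-((n : ℤ) + 1)))

/-- `w_{σ_0} ∘ w_{σ_{-1}} ∘ ⋯ ∘ w_{σ_m} x_{i(σ_m)}` with `m = -n`. -/
def codingSeq (x : V → K) (σ : ℤ → E) (n : ℕ) : K :=
  𝓜.backwardComp σ n (x (𝓜.i (σ (-(n : ℤ)))))

end Measurable

section Metric

variable [MetricSpace K] [MeasurableSpace K] (𝓜 : MarkovSystem V E K)

/-- Contractiveness on average with rate `a`. -/
def IsContractive (a : ℝ) : Prop :=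
  0 < a ∧ a < 1 ∧ ∀ v, ∀ x ∈ 𝓜.part v, ∀ y ∈ 𝓜.part v,
    ∑ e, 𝓜.p e x * dist (𝓜.w e x) (𝓜.w e y) ≤ a * dist x y

/-- The coding map `F = F_{(x_v)}`, a partial function on the code space: `F σ` is defined iff the
limit of `w_{σ_0} ∘ ⋯ ∘ w_{σ_m} x_{i(σ_m)}` as `m → -∞` exists, and is then that limit. -/
noncomputable def codingMap (x : V → K) : (ℤ → E) →. K := fun σ =>
  ⟨∃ y, Tendsto (𝓜.codingSeq x σ) atTop (𝓝 y), fun h => h.choose⟩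

/-- `D`: the `σ ∈ Σ_G` for which the limit defining the coding map exists. -/
def codingDomain (x : V → K) : Set (ℤ → E) :=
  {σ | σ ∈ 𝓜.pathSpace ∧ ∃ y, Tendsto (𝓜.codingSeq x σ) atTop (𝓝 y)}

/-- `Y = ⋂_{k ∈ ℤ} S^k(D)`. -/
def Y (x : V → K) : Set (ℤ → E) :=
  ⋂ k : ℤ, ((leftShift E ^ k : Equiv.Perm (ℤ → E)) : (ℤ → E) → (ℤ → E)) '' 𝓜.codingDomain x

/-- Each `p_e` restricted to `K_{i(e)}` is Dini-continuous. -/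
def HasDiniProbabilities : Prop :=
  ∀ e, DiniContinuous (fun z : 𝓜.part (𝓜.i e) => 𝓜.p e z)

end Metric

end MarkovSystem

/-!
Average contraction makes the distance to the base points `x_v` a drift function for the Markov
operator, so it is integrable with respect to every invariant probability measure. Under `M` the
letters `σ_{-n}, …, σ_0` are those of a path of the Markov process started from `μ`; hence the
expected distance between consecutive terms of the coding sequence decays like `a ^ n`, and the
coding sequence is almost surely Cauchy. Stationarity of `M` carries this over to all shifts, that
is, to `Y`. Since paths have positive probability of following any admissible word, the full
measure set `Y` meets every cylinder that meets `Σ_G`. The measure `M` itself is a weak limit of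
the laws of the words read from time `-n` on, which exists because `E^ℤ` is compact.
-/

section Perm

variable {α : Type*} (f : Equiv.Perm α) (s : Set α)

theorem mem_iInter_image_zpow {a : α} :
    a ∈ ⋂ k : ℤ, ((f ^ k : Equiv.Perm α) : α → α) '' s ↔ ∀ k : ℤ, (f ^ k) a ∈ s := by
  rw [Set.mem_iInter, ← (Equiv.neg ℤ).forall_congr_right]
  refine forall_congr' fun k => ?_
  rw [Equiv.image_eq_preimage_symm, Equiv.neg_apply, zpow_neg]
  rfl

theorem image_iInter_image_zpow :
    f '' ⋂ k : ℤ, ((f ^ k : Equiv.Perm α) : α → α) '' s =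
      ⋂ k : ℤ, ((f ^ k : Equiv.Perm α) : α → α) '' s := by
  rw [Set.image_iInter f.bijective,
    ← (Equiv.addLeft (1 : ℤ)).surjective.iInter_comp fun k => ((f ^ k : Equiv.Perm α) : α → α) '' s]
  simp only [Set.image_image, Equiv.coe_addLeft, zpow_one_add]
  rfl

end Perm

section CodeSpace

variable {E : Type*}

/-- The word `(σ_m, …, σ_{m+k-1})`. -/
def codeWord (σ : ℤ → E) (m : ℤ) (k : ℕ) : List E := List.ofFn fun j : Fin k => σ (m + j)

theorem codeWord_succ (σ : ℤ → E) (m : ℤ) (k : ℕ) :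
    codeWord σ m (k + 1) = σ m :: codeWord σ (m + 1) k := by
  simp [codeWord, List.ofFn_succ, add_right_comm, add_assoc]

theorem leftShift_zpow_apply (k : ℤ) (σ : ℤ → E) (j : ℤ) : (leftShift E ^ k) σ j = σ (j + k) := by
  induction k generalizing σ with
  | zero => simp
  | succ n ih =>
    rw [zpow_add_one, Equiv.Perm.mul_apply, ih, ← add_assoc]
    rfl
  | pred n ih =>
    rw [zpow_sub_one, Equiv.Perm.mul_apply, ih, ← add_sub_assoc]
    rfl

theorem codeCylinder_eq_iInter (m : ℤ) (l : List E) :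
    codeCylinder m l = ⋂ j : Fin l.length, (fun σ => σ (m + j)) ⁻¹' {l[j]} := by
  ext σ
  simp [codeCylinder, Fin.forall_iff]

theorem codeCylinder_nil (m : ℤ) : codeCylinder m ([] : List E) = Set.univ := by
  simp [codeCylinder]

theorem mem_codeCylinder_ofFn {σ : ℤ → E} {m : ℤ} {k : ℕ} {u : Fin k → E} :
    σ ∈ codeCylinder m (List.ofFn u) ↔ (fun j : Fin k => σ (m + j)) = u := by
  simp [codeCylinder, Fin.forall_iff, funext_iff]

theorem preimage_leftShift_zpow_codeCylinder (k m : ℤ) (l : List E) :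
    (leftShift E ^ k) ⁻¹' codeCylinder m l = codeCylinder (m + k) l := by
  ext σ
  simp only [codeCylinder, Set.mem_preimage, Set.mem_ofPred_eq, leftShift_zpow_apply,
    add_right_comm]

theorem isClopen_codeCylinder [TopologicalSpace E] [DiscreteTopology E] (m : ℤ) (l : List E) :
    IsClopen (codeCylinder m l) := by
  rw [codeCylinder_eq_iInter]
  exact isClopen_iInter_of_finite fun j => (isClopen_discrete _).preimage (continuous_apply _)

theorem exists_codeCylinder_codeWord_subset [TopologicalSpace E] {U : Set (ℤ → E)}
    (hU : IsOpen U) {σ : ℤ → E} (hσ : σ ∈ U) :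
    ∃ (m : ℤ) (k : ℕ), codeCylinder m (codeWord σ m k) ⊆ U := by
  obtain ⟨I, u, hu, hsub⟩ := isOpen_pi_iff.1 hU σ hσ
  set N : ℕ := I.sup Int.natAbs
  refine ⟨-N, 2 * N + 1, fun τ hτ => hsub fun j hj => ?_⟩
  have hjN : j.natAbs ≤ N := Finset.le_sup (f := Int.natAbs) hj
  have hτσ := congrFun (mem_codeCylinder_ofFn.1 hτ) ⟨(j + N).toNat, by omega⟩
  simp only [show -(N : ℤ) + (j + N).toNat = j by omega] at hτσ
  exact hτσ ▸ (hu j hj).2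

variable [MeasurableSpace E]

theorem measurable_leftShift_zpow (k : ℤ) : Measurable (leftShift E ^ k) :=
  measurable_pi_lambda _ fun j => by
    simpa only [leftShift_zpow_apply] using measurable_pi_apply (j + k)

variable [MeasurableSingletonClass E]

theorem measurableSet_codeCylinder (m : ℤ) (l : List E) : MeasurableSet (codeCylinder m l) := by
  rw [codeCylinder_eq_iInter]
  exact MeasurableSet.iInter fun j => measurable_pi_apply _ (measurableSet_singleton _)

theorem measurable_comp_codeWord [Countable E] {α : Type*} [MeasurableSpace α] (G : List E → α)
    (m : ℤ) (k : ℕ) : Measurable fun σ : ℤ → E => G (codeWord σ m k) :=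
  (Measurable.of_discrete (f := fun u : Fin k → E => G (List.ofFn u))).comp
    (measurable_pi_lambda _ fun j => measurable_pi_apply (m + j))

end CodeSpace

namespace MarkovSystem

variable {V E K : Type*} [Fintype E]

section Vertices

variable [MeasurableSpace K] (𝓜 : MarkovSystem V E K) {v v' : V} {e : E} {z : K}

theorem mem_part_of_p_ne_zero (h : 𝓜.p e z ≠ 0) : z ∈ 𝓜.part (𝓜.i e) :=
  not_imp_comm.1 (𝓜.p_zero e z) h

theorem part_eq_of_mem (h : z ∈ 𝓜.part v) (h' : z ∈ 𝓜.part v') : v = v' := by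
  by_contra hne
  exact Set.disjoint_left.1 (𝓜.part_disjoint v v' hne) h h'

theorem exists_mem_part (z : K) : ∃ v, z ∈ 𝓜.part v :=
  Set.mem_iUnion.1 (𝓜.part_cover ▸ Set.mem_univ z)

theorem exists_p_ne_zero (z : K) : ∃ e, 𝓜.p e z ≠ 0 := by
  obtain ⟨e, -, he⟩ := Finset.exists_ne_zero_of_sum_ne_zero (s := .univ) (f := (𝓜.p · z))
    (by simp [𝓜.p_sum])
  exact ⟨e, he⟩

theorem i_surjective : Function.Surjective 𝓜.i := fun v => by
  obtain ⟨z, hz⟩ := 𝓜.part_nonempty v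
  obtain ⟨e, he⟩ := 𝓜.exists_p_ne_zero z
  exact ⟨e, 𝓜.part_eq_of_mem (𝓜.mem_part_of_p_ne_zero he) hz⟩

theorem sum_ofReal_p (z : K) : ∑ e, ENNReal.ofReal (𝓜.p e z) = 1 := by
  rw [← ENNReal.ofReal_sum_of_nonneg fun e _ => 𝓜.p_nonneg e z, 𝓜.p_sum, ENNReal.ofReal_one]

theorem ofReal_p_le_one (e : E) (z : K) : ENNReal.ofReal (𝓜.p e z) ≤ 1 :=
  (Finset.single_le_sum_of_canonicallyOrdered (Finset.mem_univ e)).trans_eq (𝓜.sum_ofReal_p z)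

theorem sum_ofReal_p_mul_le_sum (hz : z ∈ 𝓜.part v) {f g : E → ℝ≥0∞}
    (h : ∀ e, 𝓜.i e = v → f e ≤ g e) :
    ∑ e, ENNReal.ofReal (𝓜.p e z) * f e ≤ ∑ e, ENNReal.ofReal (𝓜.p e z) * g e := by
  refine Finset.sum_le_sum fun e _ => ?_
  by_cases he : 𝓜.p e z = 0
  · simp [he]
  · gcongr
    exact h e (𝓜.part_eq_of_mem (𝓜.mem_part_of_p_ne_zero he) hz)

end Vertices

section MarkovOperator

variable [MeasurableSpace K] (𝓜 : MarkovSystem V E K)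

/-- The Markov operator on `[0, ∞]`-valued functions, where no boundedness or integrability has to
be assumed. -/
noncomputable def lmarkovOp (f : K → ℝ≥0∞) (z : K) : ℝ≥0∞ :=
  ∑ e, ENNReal.ofReal (𝓜.p e z) * f (𝓜.w e z)

/-- The adjoint `U^*` of the Markov operator, acting on measures: the law after one step of the
process with initial law `μ`. -/
noncomputable def markovDual (μ : Measure K) : Measure K :=
  ∑ e, (μ.withDensity fun z => ENNReal.ofReal (𝓜.p e z)).map (𝓜.w e)

theorem measurable_lmarkovOp {f : K → ℝ≥0∞} (hf : Measurable f) : Measurable (𝓜.lmarkovOp f) :=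
  Finset.measurable_sum _ fun e _ =>
    (𝓜.p_measurable e).ennreal_ofReal.mul (hf.comp (𝓜.w_measurable e))

theorem measurable_lmarkovOp_iterate {f : K → ℝ≥0∞} (hf : Measurable f) (k : ℕ) :
    Measurable (𝓜.lmarkovOp^[k] f) := by
  induction k with
  | zero => exact hf
  | succ k ih => exact Function.iterate_succ_apply' 𝓜.lmarkovOp k f ▸ 𝓜.measurable_lmarkovOp ih

theorem lmarkovOp_monotone : Monotone 𝓜.lmarkovOp :=
  fun _ _ h _ => Finset.sum_le_sum fun _ _ => mul_le_mul_right (h _) _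

theorem lmarkovOp_mul_add_const (b c : ℝ≥0∞) (f : K → ℝ≥0∞) :
    𝓜.lmarkovOp (fun z => b * f z + c) = fun z => b * 𝓜.lmarkovOp f z + c := by
  funext z
  simp only [lmarkovOp, mul_add, Finset.sum_add_distrib, ← Finset.sum_mul, 𝓜.sum_ofReal_p, one_mul,
    Finset.mul_sum, mul_left_comm b]

theorem lmarkovOp_const (c : ℝ≥0∞) : 𝓜.lmarkovOp (fun _ => c) = fun _ => c := by
  simpa using 𝓜.lmarkovOp_mul_add_const 0 c 0

theorem lmarkovOp_ofReal {f : K → ℝ} (hf : 0 ≤ f) (z : K) :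
    𝓜.lmarkovOp (fun z => ENNReal.ofReal (f z)) z = ENNReal.ofReal (𝓜.markovOp f z) := by
  rw [markovOp, ENNReal.ofReal_sum_of_nonneg fun e _ => mul_nonneg (𝓜.p_nonneg e z) (hf _)]
  simp only [lmarkovOp, ENNReal.ofReal_mul (𝓜.p_nonneg _ z)]

theorem lintegral_markovDual (μ : Measure K) {f : K → ℝ≥0∞} (hf : Measurable f) :
    ∫⁻ z, f z ∂𝓜.markovDual μ = ∫⁻ z, 𝓜.lmarkovOp f z ∂μ := by
  have hp e : Measurable fun z => ENNReal.ofReal (𝓜.p e z) := (𝓜.p_measurable e).ennreal_ofReal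
  have hfw e : Measurable fun z => f (𝓜.w e z) := hf.comp (𝓜.w_measurable e)
  simp only [lmarkovOp]
  rw [markovDual, lintegral_finsetSum_measure,
    lintegral_finsetSum (f := fun e z => ENNReal.ofReal (𝓜.p e z) * f (𝓜.w e z)) _
      fun e _ => (hp e).mul (hfw e)]
  refine Finset.sum_congr rfl fun e _ => ?_
  rw [lintegral_map hf (𝓜.w_measurable e)]
  exact lintegral_withDensity_eq_lintegral_mul _ (hp e) (hfw e)

namespace IsInvariant

variable {𝓜} {μ : Measure K} [IsFiniteMeasure μ] (hμ : 𝓜.IsInvariant μ)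
include hμ

theorem markovDual_eq : 𝓜.markovDual μ = μ := by
  ext A hA
  set f : K → ℝ := A.indicator 1
  have hf : Measurable f := measurable_one.indicator hA
  have hf0 : 0 ≤ f := Set.indicator_nonneg fun _ _ => zero_le_one
  have hf1 z : f z ≤ 1 := Set.indicator_le' (fun _ _ => le_rfl) (fun _ _ => zero_le_one) z
  have hUf0 z : 0 ≤ 𝓜.markovOp f z :=
    Finset.sum_nonneg fun e _ => mul_nonneg (𝓜.p_nonneg e z) (hf0 _)
  have hUf1 z : 𝓜.markovOp f z ≤ 1 := by
    rw [← 𝓜.p_sum z]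
    exact Finset.sum_le_sum fun e _ => mul_le_of_le_one_right (𝓜.p_nonneg e z) (hf1 _)
  have hUf : Measurable (𝓜.markovOp f) := Finset.measurable_sum _ fun e _ =>
    (𝓜.p_measurable e).mul (hf.comp (𝓜.w_measurable e))
  have hUf_int : Integrable (𝓜.markovOp f) μ := .of_bound (C := 1) hUf.aestronglyMeasurable
    (ae_of_all _ fun z => (Real.norm_of_nonneg (hUf0 z)).trans_le (hUf1 z))
  have h_ind : A.indicator (1 : K → ℝ≥0∞) = fun z => ENNReal.ofReal (f z) := by
    funext z
    by_cases hz : z ∈ A <;> simp [f, hz]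
  calc 𝓜.markovDual μ A = ∫⁻ z, 𝓜.lmarkovOp (A.indicator 1) z ∂μ := by
        rw [← lintegral_indicator_one hA, 𝓜.lintegral_markovDual μ (measurable_one.indicator hA)]
    _ = ∫⁻ z, ENNReal.ofReal (𝓜.markovOp f z) ∂μ := by
        simp only [h_ind, 𝓜.lmarkovOp_ofReal hf0]
    _ = ENNReal.ofReal (∫ z, f z ∂μ) := by
        rw [← hμ f hf ⟨1, fun z => (abs_of_nonneg (hf0 z)).trans_le (hf1 z)⟩,
          ofReal_integral_eq_lintegral_ofReal hUf_int (ae_of_all _ hUf0)]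
    _ = μ A := by rw [integral_indicator_one hA, ofReal_measureReal]

theorem lintegral_lmarkovOp {f : K → ℝ≥0∞} (hf : Measurable f) :
    ∫⁻ z, 𝓜.lmarkovOp f z ∂μ = ∫⁻ z, f z ∂μ := by
  rw [← 𝓜.lintegral_markovDual μ hf, hμ.markovDual_eq]

theorem lintegral_lmarkovOp_iterate {f : K → ℝ≥0∞} (hf : Measurable f) (k : ℕ) :
    ∫⁻ z, 𝓜.lmarkovOp^[k] f z ∂μ = ∫⁻ z, f z ∂μ := by
  induction k with
  | zero => rfl
  | succ k ih =>
    rw [Function.iterate_succ_apply',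
      hμ.lintegral_lmarkovOp (𝓜.measurable_lmarkovOp_iterate hf k), ih]

end IsInvariant

end MarkovOperator

section Drift

variable [MeasurableSpace K] {𝓜 : MarkovSystem V E K} {f : K → ℝ≥0∞} {b c : ℝ≥0∞}

theorem lmarkovOp_iterate_le_of_drift (h : ∀ z, 𝓜.lmarkovOp f z ≤ b * f z + c) (k : ℕ) (z : K) :
    𝓜.lmarkovOp^[k] f z ≤ b ^ k * f z + (1 - b)⁻¹ * c := by
  have hsum : 𝓜.lmarkovOp^[k] f z ≤ b ^ k * f z + (∑ j ∈ Finset.range k, b ^ j) * c := by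
    induction k generalizing z with
    | zero => simp
    | succ k ih =>
      rw [Function.iterate_succ_apply']
      calc 𝓜.lmarkovOp (𝓜.lmarkovOp^[k] f) z
          ≤ b ^ k * 𝓜.lmarkovOp f z + (∑ j ∈ Finset.range k, b ^ j) * c :=
            (𝓜.lmarkovOp_monotone ih z).trans_eq (congrFun (𝓜.lmarkovOp_mul_add_const _ _ f) z)
        _ ≤ b ^ k * (b * f z + c) + (∑ j ∈ Finset.range k, b ^ j) * c := by gcongr; exact h z
        _ = b ^ (k + 1) * f z + (∑ j ∈ Finset.range (k + 1), b ^ j) * c := by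
            rw [Finset.sum_range_succ]
            ring
  refine hsum.trans ?_
  gcongr
  exact (ENNReal.sum_le_tsum _).trans_eq (ENNReal.tsum_geometric b)

variable {μ : Measure K} [IsFiniteMeasure μ] (hμ : 𝓜.IsInvariant μ) (hf : Measurable f)
  (hfin : ∀ z, f z ≠ ∞) (hb : b < 1) (h : ∀ z, 𝓜.lmarkovOp f z ≤ b * f z + c)
include hμ hf hfin hb h

-- Invariance allows `f ∧ n` to be replaced by its `k`-th iterate, which is dominated by `n` and, as
-- `k → ∞`, bounded by `c / (1 - b)`. The truncation is needed because `f` might not be integrable.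
theorem IsInvariant.lintegral_min_natCast_le_of_drift (n : ℕ) :
    ∫⁻ z, min (f z) n ∂μ ≤ (1 - b)⁻¹ * c * μ Set.univ := by
  have h_iterate (k : ℕ) :
      ∫⁻ z, min (f z) n ∂μ ≤ ∫⁻ z, min (b ^ k * f z + (1 - b)⁻¹ * c) n ∂μ := by
    rw [← hμ.lintegral_lmarkovOp_iterate (hf.min measurable_const) k]
    refine lintegral_mono fun z => le_min ?_ ?_
    · exact (𝓜.lmarkovOp_monotone.iterate k (fun z => min_le_left _ _) z).trans
        (lmarkovOp_iterate_le_of_drift h k z)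
    · exact (𝓜.lmarkovOp_monotone.iterate k (fun z => min_le_right _ _) z).trans_eq
        (congrFun (Function.iterate_fixed (𝓜.lmarkovOp_const n) k) z)
  have h_tendsto : Tendsto (fun k => ∫⁻ z, min (b ^ k * f z + (1 - b)⁻¹ * c) n ∂μ) atTop
      (𝓝 (∫⁻ _, min (0 + (1 - b)⁻¹ * c) n ∂μ)) := by
    refine tendsto_lintegral_of_dominated_convergence (fun _ => n)
      (fun k => ((hf.const_mul _).add_const _).min measurable_const)
      (fun k => ae_of_all _ fun z => min_le_right _ _)
      (by simp [lintegral_const, ENNReal.mul_ne_top, measure_ne_top]) (ae_of_all _ fun z => ?_)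
    have h_pow := ENNReal.Tendsto.mul_const
      (ENNReal.tendsto_pow_atTop_nhds_zero_of_lt_one hb) (Or.inr (hfin z))
    rw [zero_mul] at h_pow
    exact (h_pow.add_const _).min tendsto_const_nhds
  calc ∫⁻ z, min (f z) n ∂μ ≤ ∫⁻ _, min (0 + (1 - b)⁻¹ * c) n ∂μ :=
        ge_of_tendsto' h_tendsto h_iterate
    _ ≤ ∫⁻ _, (1 - b)⁻¹ * c ∂μ := lintegral_mono fun _ => by simp
    _ = (1 - b)⁻¹ * c * μ Set.univ := lintegral_const _

theorem IsInvariant.lintegral_le_of_drift : ∫⁻ z, f z ∂μ ≤ (1 - b)⁻¹ * c * μ Set.univ := by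
  have h_iSup z : f z = ⨆ n : ℕ, min (f z) n := by
    rw [← inf_iSup_eq, ENNReal.iSup_natCast, inf_top_eq]
  rw [lintegral_congr h_iSup, lintegral_iSup (fun n => hf.min measurable_const)
    fun m n hmn z => min_le_min_left _ (Nat.cast_le.2 hmn)]
  exact iSup_le (hμ.lintegral_min_natCast_le_of_drift hf hfin hb h)

end Drift

section Paths

variable [MeasurableSpace K] (𝓜 : MarkovSystem V E K)

/-- `w_{e_k} ∘ ⋯ ∘ w_{e₁}` for the word `[e₁, …, e_k]`, so that the path starting at `z` and
following the word ends at its value at `z`. -/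
def pathMap : List E → K → K
  | [], z => z
  | e :: l, z => pathMap l (𝓜.w e z)

/-- The expectation of `G [e₁, …, e_k]` for the random letters `e₁, …, e_k` of the path of the
Markov process started at `z`. -/
noncomputable def pathExpect (k : ℕ) (G : List E → ℝ≥0∞) (z : K) : ℝ≥0∞ :=
  ∑ u : Fin k → E, ENNReal.ofReal (𝓜.pathProb (List.ofFn u) z) * G (List.ofFn u)

theorem backwardComp_eq_pathMap (σ : ℤ → E) (n : ℕ) :
    𝓜.backwardComp σ n = 𝓜.pathMap (codeWord σ (-n) (n + 1)) := by
  induction n with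
  | zero => simp [backwardComp, codeWord, pathMap]
  | succ n ih =>
    funext z
    rw [codeWord_succ, backwardComp, ih, pathMap, Nat.cast_succ, neg_add_rev, neg_add_cancel_comm,
      Function.comp_apply]

theorem measurable_ofReal_pathProb (l : List E) :
    Measurable fun z => ENNReal.ofReal (𝓜.pathProb l z) := by
  refine Measurable.ennreal_ofReal ?_
  induction l with
  | nil => exact measurable_const (a := (1 : ℝ))
  | cons e l ih => exact (𝓜.p_measurable e).mul (ih.comp (𝓜.w_measurable e))

theorem pathExpect_zero (G : List E → ℝ≥0∞) (z : K) : 𝓜.pathExpect 0 G z = G [] := by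
  simp [pathExpect, pathProb]

theorem pathExpect_succ (k : ℕ) (G : List E → ℝ≥0∞) (z : K) :
    𝓜.pathExpect (k + 1) G z =
      ∑ e, ENNReal.ofReal (𝓜.p e z) * 𝓜.pathExpect k (fun l => G (e :: l)) (𝓜.w e z) := by
  rw [pathExpect, ← (Fin.consEquiv fun _ => E).sum_comp, Fintype.sum_prod_type]
  simp [pathExpect, pathProb, ENNReal.ofReal_mul (𝓜.p_nonneg _ _), Finset.mul_sum,
    mul_assoc]

theorem pathExpect_one (k : ℕ) (z : K) : 𝓜.pathExpect k 1 z = 1 := by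
  induction k generalizing z with
  | zero => exact 𝓜.pathExpect_zero 1 z
  | succ k ih =>
    calc 𝓜.pathExpect (k + 1) 1 z = ∑ e, ENNReal.ofReal (𝓜.p e z) * 𝓜.pathExpect k 1 (𝓜.w e z) :=
          𝓜.pathExpect_succ k 1 z
      _ = 1 := by simp only [ih, mul_one, 𝓜.sum_ofReal_p]

theorem pathExpect_mono (k : ℕ) {G H : List E → ℝ≥0∞} (h : ∀ l, G l ≤ H l) (z : K) :
    𝓜.pathExpect k G z ≤ 𝓜.pathExpect k H z :=
  Finset.sum_le_sum fun _ _ => mul_le_mul_right (h _) _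

theorem pathExpect_add (k : ℕ) (G H : List E → ℝ≥0∞) (z : K) :
    𝓜.pathExpect k (fun l => G l + H l) z = 𝓜.pathExpect k G z + 𝓜.pathExpect k H z := by
  simp only [pathExpect, mul_add, Finset.sum_add_distrib]

theorem lintegral_pathExpect (μ : Measure K) (k : ℕ) (G : List E → ℝ≥0∞) :
    ∫⁻ z, 𝓜.pathExpect k G z ∂μ = ∑ u : Fin k → E,
      (∫⁻ z, ENNReal.ofReal (𝓜.pathProb (List.ofFn u) z) ∂μ) * G (List.ofFn u) := by
  simp only [pathExpect]
  rw [lintegral_finsetSum _ fun u _ => (𝓜.measurable_ofReal_pathProb _).mul_const _]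
  simp only [lintegral_mul_const _ (𝓜.measurable_ofReal_pathProb _)]

theorem pathExpect_indicator_prefix_drop {r k : ℕ} {l : List E} (h : r + l.length ≤ k) (z : K) :
    𝓜.pathExpect k ({l' | l <+: l'.drop r}.indicator 1) z =
      𝓜.lmarkovOp^[r] (fun z => ENNReal.ofReal (𝓜.pathProb l z)) z := by
  induction k generalizing r l z with
  | zero =>
    obtain ⟨rfl, hl⟩ := Nat.add_eq_zero_iff.1 (Nat.le_zero.1 h)
    simp [List.length_eq_zero_iff.1 hl, pathExpect_zero, pathProb]
  | succ k ih =>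
    rw [pathExpect_succ]
    rcases r with - | r
    · rcases l with - | ⟨e, l⟩
      · simpa [pathExpect_succ, pathProb] using 𝓜.pathExpect_one (k + 1) z
      · rw [Finset.sum_eq_single e (fun e' _ hne => by simp [hne.symm, pathExpect]) (by simp)]
        simp only [Function.iterate_zero, id, pathProb, ENNReal.ofReal_mul (𝓜.p_nonneg e z)]
        have h_cons : (fun l' => {l' | e :: l <+: l'.drop 0}.indicator 1 (e :: l')) =
            {l' | l <+: l'.drop 0}.indicator (1 : List E → ℝ≥0∞) :=
          funext fun l' => Set.indicator_const_eq_indicator_const (by simp)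
        rw [h_cons, ih (by simpa using h), Function.iterate_zero, id]
    · rw [Function.iterate_succ_apply', lmarkovOp]
      exact Finset.sum_congr rfl fun e _ => congrArg _ (ih (by omega) (𝓜.w e z))

variable {𝓜} in
theorem pathProb_codeWord_pos (hp : ∀ e, ∀ z ∈ 𝓜.part (𝓜.i e), 0 < 𝓜.p e z) {σ : ℤ → E}
    (hσ : σ ∈ 𝓜.pathSpace) (m : ℤ) (k : ℕ) {z : K} (hz : z ∈ 𝓜.part (𝓜.i (σ m))) :
    0 < 𝓜.pathProb (codeWord σ m k) z := by
  induction k generalizing m z with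
  | zero => simp [codeWord, pathProb]
  | succ k ih =>
    rw [codeWord_succ]
    exact mul_pos (hp _ z hz) (ih (m + 1) (hσ m ▸ 𝓜.w_mapsTo _ hz))

end Paths

section Existence

variable [MeasurableSpace K] [MeasurableSpace E] (𝓜 : MarkovSystem V E K)

/-- The law of the bi-infinite code whose letters at the times `-n, …, n - 1` are those of the path
of the Markov process with law `μ` at time `-n`. The other letters are junk: earlier ones repeat the
letter at time `-n` (`Int.toNat` truncates), later ones are `e₀`. -/
noncomputable def approxMarkovMeasure (μ : Measure K) (e₀ : E) (n : ℕ) : Measure (ℤ → E) :=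
  ∑ u : Fin (2 * n) → E, (∫⁻ z, ENNReal.ofReal (𝓜.pathProb (List.ofFn u) z) ∂μ) •
    Measure.dirac fun j : ℤ => (List.ofFn u).getD (j + n).toNat e₀

variable [MeasurableSingletonClass E] {μ : Measure K}

theorem approxMarkovMeasure_codeCylinder [IsFiniteMeasure μ] (hμ : 𝓜.IsInvariant μ) (e₀ : E)
    {n : ℕ} {m : ℤ} {l : List E} (hm : -n ≤ m) (hl : m + l.length ≤ n) :
    𝓜.approxMarkovMeasure μ e₀ n (codeCylinder m l) =
      ∫⁻ z, ENNReal.ofReal (𝓜.pathProb l z) ∂μ := by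
  obtain ⟨r, rfl⟩ : ∃ r : ℕ, m = r - n := ⟨(m + n).toNat, by omega⟩
  have h_mem (u : Fin (2 * n) → E) :
      (fun j : ℤ => (List.ofFn u).getD (j + n).toNat e₀) ∈ codeCylinder (r - n) l ↔
        List.ofFn u ∈ {l' | l <+: l'.drop r} := by
    rw [Set.mem_ofPred_eq, List.prefix_iff_getElem?]
    refine forall₂_congr fun j hj => ?_
    have hrj : r + j < (List.ofFn u).length := by
      rw [List.length_ofFn]
      omega
    change (List.ofFn u).getD (r - n + j + n : ℤ).toNat e₀ = l[j] ↔ _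
    rw [show (r - n + j + n : ℤ).toNat = r + j by omega, List.getD_eq_getElem _ _ hrj,
      List.getElem?_drop, List.getElem?_eq_getElem hrj, Option.some_inj]
  calc 𝓜.approxMarkovMeasure μ e₀ n (codeCylinder (r - n) l)
      = ∫⁻ z, 𝓜.pathExpect (2 * n) ({l' | l <+: l'.drop r}.indicator 1) z ∂μ := by
        rw [lintegral_pathExpect, approxMarkovMeasure, Measure.finsetSum_apply]
        refine Finset.sum_congr rfl fun u _ => ?_
        rw [Measure.smul_apply, smul_eq_mul,
          Measure.dirac_apply' _ (measurableSet_codeCylinder _ _)]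
        exact congrArg _ (Set.indicator_const_eq_indicator_const (h_mem u))
    _ = ∫⁻ z, 𝓜.lmarkovOp^[r] (fun z => ENNReal.ofReal (𝓜.pathProb l z)) z ∂μ :=
        lintegral_congr fun z => 𝓜.pathExpect_indicator_prefix_drop (by omega) z
    _ = ∫⁻ z, ENNReal.ofReal (𝓜.pathProb l z) ∂μ :=
        hμ.lintegral_lmarkovOp_iterate (𝓜.measurable_ofReal_pathProb l) r

variable [IsProbabilityMeasure μ]

theorem isProbabilityMeasure_approxMarkovMeasure (hμ : 𝓜.IsInvariant μ) (e₀ : E) (n : ℕ) :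
    IsProbabilityMeasure (𝓜.approxMarkovMeasure μ e₀ n) := by
  constructor
  rw [← codeCylinder_nil 0, 𝓜.approxMarkovMeasure_codeCylinder hμ e₀ (by simp) (by simp)]
  simp [pathProb]

theorem exists_isGeneralizedMarkovMeasure (hμ : 𝓜.IsInvariant μ) :
    ∃ M, 𝓜.IsGeneralizedMarkovMeasure μ M := by
  let : TopologicalSpace E := ⊥
  have : DiscreteTopology E := ⟨rfl⟩
  have : OpensMeasurableSpace E := ⟨fun _ _ => .of_discrete⟩
  obtain ⟨z⟩ := nonempty_of_isProbabilityMeasure μ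
  obtain ⟨e₀, -⟩ := 𝓜.exists_p_ne_zero z
  let P (n : ℕ) : ProbabilityMeasure (ℤ → E) :=
    ⟨𝓜.approxMarkovMeasure μ e₀ n, 𝓜.isProbabilityMeasure_approxMarkovMeasure hμ e₀ n⟩
  let F : Ultrafilter ℕ := Ultrafilter.of atTop
  obtain ⟨M, -, hM : Tendsto P F (𝓝 M)⟩ :=
    isCompact_univ.ultrafilter_le_nhds (F.map P) (by simp)
  refine ⟨M, inferInstance, fun m l => ?_⟩
  have h_tendsto := ProbabilityMeasure.tendsto_measure_of_null_frontier_of_tendsto' hM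
    (E := codeCylinder m l) (by simp [(isClopen_codeCylinder m l).frontier_eq])
  refine tendsto_nhds_unique h_tendsto (tendsto_const_nhds.congr' (Ultrafilter.of_le _ ?_))
  filter_upwards [eventually_ge_atTop (m.natAbs + l.length)] with n hn
  exact (𝓜.approxMarkovMeasure_codeCylinder hμ e₀ (by omega) (by omega)).symm

theorem isGeneralizedMarkovMeasure_generalizedMarkovMeasure (hμ : 𝓜.IsInvariant μ) :
    𝓜.IsGeneralizedMarkovMeasure μ (𝓜.generalizedMarkovMeasure μ) := by
  have h := 𝓜.exists_isGeneralizedMarkovMeasure hμ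
  rw [generalizedMarkovMeasure, dif_pos h]
  exact h.choose_spec

end Existence

namespace IsGeneralizedMarkovMeasure

variable [MeasurableSpace K] [MeasurableSpace E] {𝓜 : MarkovSystem V E K} {μ : Measure K}
  {M : Measure (ℤ → E)} (hM : 𝓜.IsGeneralizedMarkovMeasure μ M)
include hM

theorem lintegral_codeWord [MeasurableSingletonClass E] (k : ℕ) (G : List E → ℝ≥0∞) (m : ℤ) :
    ∫⁻ σ, G (codeWord σ m k) ∂M = ∫⁻ z, 𝓜.pathExpect k G z ∂μ := by
  have h_block : Measurable fun (σ : ℤ → E) (j : Fin k) => σ (m + j) :=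
    measurable_pi_lambda _ fun j => measurable_pi_apply (m + j)
  calc ∫⁻ σ, G (codeWord σ m k) ∂M
      = ∫⁻ u, G (List.ofFn u) ∂M.map fun σ (j : Fin k) => σ (m + j) :=
        (lintegral_map (f := fun u => G (List.ofFn u)) .of_discrete h_block).symm
    _ = ∑ u : Fin k → E, M (codeCylinder m (List.ofFn u)) * G (List.ofFn u) := by
        rw [lintegral_fintype]
        refine Finset.sum_congr rfl fun u _ => ?_
        rw [Measure.map_apply h_block (measurableSet_singleton u), mul_comm]
        congr 2
        ext σ
        exact mem_codeCylinder_ofFn.symm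
    _ = ∫⁻ z, 𝓜.pathExpect k G z ∂μ := by
        simp only [hM.cylinder_eq, lintegral_pathExpect]

theorem map_leftShift_zpow [MeasurableSingletonClass E] (k : ℤ) :
    𝓜.IsGeneralizedMarkovMeasure μ (M.map (leftShift E ^ k)) where
  isProbabilityMeasure :=
    have := hM.isProbabilityMeasure
    Measure.isProbabilityMeasure_map (measurable_leftShift_zpow k).aemeasurable
  cylinder_eq m l := by
    rw [Measure.map_apply (measurable_leftShift_zpow k) (measurableSet_codeCylinder m l),
      preimage_leftShift_zpow_codeCylinder, hM.cylinder_eq]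

theorem ae_mem_pathSpace : ∀ᵐ σ ∂M, σ ∈ 𝓜.pathSpace := by
  have h_null (j : ℤ) {e e' : E} (hne : 𝓜.t e ≠ 𝓜.i e') : M (codeCylinder j [e, e']) = 0 := by
    have h_zero z : 𝓜.pathProb [e, e'] z = 0 := by
      by_contra h0
      simp only [pathProb, mul_one, mul_ne_zero_iff] at h0
      exact hne (𝓜.part_eq_of_mem (𝓜.w_mapsTo e (𝓜.mem_part_of_p_ne_zero h0.1))
        (𝓜.mem_part_of_p_ne_zero h0.2))
    simp [hM.cylinder_eq, h_zero]
  have h_ae : ∀ᵐ σ ∂M, ∀ (j : ℤ) (e e' : E), 𝓜.t e ≠ 𝓜.i e' → σ ∉ codeCylinder j [e, e'] := by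
    simp only [ae_all_iff]
    exact fun j e e' hne => measure_eq_zero_iff_ae_notMem.1 (h_null j hne)
  filter_upwards [h_ae] with σ hσ j
  by_contra hne
  exact hσ j _ _ hne (by simpa [codeWord] using mem_codeCylinder_ofFn (m := j) (k := 2).2 rfl)

theorem measure_codeCylinder_codeWord_pos (hp : ∀ e, ∀ z ∈ 𝓜.part (𝓜.i e), 0 < 𝓜.p e z)
    (hpos : ∀ e, 0 < μ (𝓜.part (𝓜.i e))) {σ : ℤ → E} (hσ : σ ∈ 𝓜.pathSpace) (m : ℤ) (k : ℕ) :
    0 < M (codeCylinder m (codeWord σ m k)) := by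
  rw [hM.cylinder_eq, lintegral_pos_iff_support (𝓜.measurable_ofReal_pathProb _)]
  refine (hpos (σ m)).trans_le (measure_mono fun z hz => ?_)
  simpa using pathProb_codeWord_pos hp hσ m k hz

end IsGeneralizedMarkovMeasure

section Contraction

variable [MetricSpace K] [MeasurableSpace K] {𝓜 : MarkovSystem V E K} {a : ℝ}

theorem IsContractive.ofReal_lt_one (ha : 𝓜.IsContractive a) : ENNReal.ofReal a < 1 :=
  ENNReal.ofReal_lt_one.2 ha.2.1

theorem IsContractive.sum_ofReal_p_mul_edist_le (ha : 𝓜.IsContractive a) {v : V} {y z : K}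
    (hy : y ∈ 𝓜.part v) (hz : z ∈ 𝓜.part v) :
    ∑ e, ENNReal.ofReal (𝓜.p e y) * edist (𝓜.w e y) (𝓜.w e z) ≤ ENNReal.ofReal a * edist y z := by
  simp only [edist_dist, ← ENNReal.ofReal_mul ha.1.le, ← ENNReal.ofReal_mul (𝓜.p_nonneg _ y)]
  rw [← ENNReal.ofReal_sum_of_nonneg fun e _ => mul_nonneg (𝓜.p_nonneg e y) dist_nonneg]
  exact ENNReal.ofReal_le_ofReal (ha.2.2 v y hy z hz)

theorem IsContractive.pathExpect_edist_le (ha : 𝓜.IsContractive a) (k : ℕ) {v : V} {y z : K}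
    (hy : y ∈ 𝓜.part v) (hz : z ∈ 𝓜.part v) :
    𝓜.pathExpect k (fun l => edist (𝓜.pathMap l y) (𝓜.pathMap l z)) y ≤
      ENNReal.ofReal a ^ k * edist y z := by
  induction k generalizing v y z with
  | zero => simp [pathExpect_zero, pathMap]
  | succ k ih =>
    rw [pathExpect_succ]
    calc ∑ e, ENNReal.ofReal (𝓜.p e y) * 𝓜.pathExpect k
            (fun l => edist (𝓜.pathMap l (𝓜.w e y)) (𝓜.pathMap l (𝓜.w e z))) (𝓜.w e y)
        ≤ ∑ e, ENNReal.ofReal (𝓜.p e y) *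
            (ENNReal.ofReal a ^ k * edist (𝓜.w e y) (𝓜.w e z)) := by
          refine 𝓜.sum_ofReal_p_mul_le_sum hy ?_
          rintro e rfl
          exact ih (𝓜.w_mapsTo e hy) (𝓜.w_mapsTo e hz)
      _ = ENNReal.ofReal a ^ k * ∑ e, ENNReal.ofReal (𝓜.p e y) * edist (𝓜.w e y) (𝓜.w e z) := by
          simp only [Finset.mul_sum, mul_left_comm]
      _ ≤ ENNReal.ofReal a ^ k * (ENNReal.ofReal a * edist y z) := by
          gcongr
          exact ha.sum_ofReal_p_mul_edist_le hy hz
      _ = ENNReal.ofReal a ^ (k + 1) * edist y z := by rw [pow_succ, mul_assoc]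

variable (𝓜) in
/-- The distance from a point to the base point of the vertex set containing it; as the vertex sets
are disjoint, the supremum has at most one non-zero term. It serves as a drift function for the
Markov operator. -/
noncomputable def baseEDist (x : V → K) (z : K) : ℝ≥0∞ :=
  ⨆ v, (𝓜.part v).indicator (fun z => edist z (x v)) z

theorem baseEDist_of_mem (x : V → K) {v : V} {z : K} (hz : z ∈ 𝓜.part v) :
    𝓜.baseEDist x z = edist z (x v) := by
  refine le_antisymm (iSup_le fun v' => ?_) ?_
  · refine Set.indicator_apply_le' (fun hz' => ?_) fun _ => zero_le
    rw [𝓜.part_eq_of_mem hz hz']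
  · exact le_iSup_of_le v (Set.indicator_of_mem hz fun z => edist z (x v)).ge

theorem measurable_baseEDist [OpensMeasurableSpace K] (x : V → K) :
    Measurable (𝓜.baseEDist x) := by
  have := Finite.of_surjective _ 𝓜.i_surjective
  exact .iSup fun v =>
    (continuous_id.edist continuous_const).measurable.indicator (𝓜.part_measurable v)

theorem baseEDist_ne_top (x : V → K) (z : K) : 𝓜.baseEDist x z ≠ ∞ := by
  obtain ⟨v, hv⟩ := 𝓜.exists_mem_part z
  exact baseEDist_of_mem x hv ▸ edist_ne_top _ _

variable {x : V → K} (hx : ∀ v, x v ∈ 𝓜.part v)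
include hx

theorem IsContractive.lmarkovOp_baseEDist_le (ha : 𝓜.IsContractive a) (z : K) :
    𝓜.lmarkovOp (𝓜.baseEDist x) z ≤ ENNReal.ofReal a * 𝓜.baseEDist x z +
      ∑ e, edist (𝓜.w e (x (𝓜.i e))) (x (𝓜.t e)) := by
  obtain ⟨v, hz⟩ := 𝓜.exists_mem_part z
  calc 𝓜.lmarkovOp (𝓜.baseEDist x) z
      ≤ ∑ e, ENNReal.ofReal (𝓜.p e z) *
          (edist (𝓜.w e z) (𝓜.w e (x v)) + edist (𝓜.w e (x (𝓜.i e))) (x (𝓜.t e))) := by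
        refine 𝓜.sum_ofReal_p_mul_le_sum hz ?_
        rintro e rfl
        rw [baseEDist_of_mem x (𝓜.w_mapsTo e hz)]
        exact edist_triangle _ _ _
    _ ≤ ∑ e, ENNReal.ofReal (𝓜.p e z) * edist (𝓜.w e z) (𝓜.w e (x v)) +
          ∑ e, edist (𝓜.w e (x (𝓜.i e))) (x (𝓜.t e)) := by
        simp only [mul_add, Finset.sum_add_distrib]
        gcongr with e
        exact mul_le_of_le_one_left zero_le (𝓜.ofReal_p_le_one e z)
    _ ≤ ENNReal.ofReal a * 𝓜.baseEDist x z +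
          ∑ e, edist (𝓜.w e (x (𝓜.i e))) (x (𝓜.t e)) := by
        rw [baseEDist_of_mem x hz]
        gcongr
        exact ha.sum_ofReal_p_mul_edist_le hz (hx v)

theorem IsContractive.lintegral_baseEDist_ne_top [OpensMeasurableSpace K]
    (ha : 𝓜.IsContractive a) {μ : Measure K} [IsFiniteMeasure μ] (hμ : 𝓜.IsInvariant μ) :
    ∫⁻ z, 𝓜.baseEDist x z ∂μ ≠ ∞ := by
  refine ne_top_of_le_ne_top ?_ (hμ.lintegral_le_of_drift (measurable_baseEDist x)
    (baseEDist_ne_top x) ha.ofReal_lt_one (ha.lmarkovOp_baseEDist_le hx))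
  simp [ENNReal.mul_eq_top, tsub_eq_zero_iff_le, ha.2.1, edist_ne_top]

end Contraction

section Coding

variable [MetricSpace K] [MeasurableSpace K] {𝓜 : MarkovSystem V E K} {a : ℝ}

variable (𝓜) in
/-- The distance between consecutive terms of the coding sequence, as a function of the word read
by the later one: the earlier term starts at the base point reached by the first letter. -/
noncomputable def codingDefect (x : V → K) : List E → ℝ≥0∞
  | [] => 0
  | e :: l => edist (𝓜.pathMap l (x (𝓜.t e))) (𝓜.pathMap l (𝓜.w e (x (𝓜.i e))))

theorem edist_codingSeq_succ (x : V → K) {σ : ℤ → E} (hσ : σ ∈ 𝓜.pathSpace) (n : ℕ) :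
    edist (𝓜.codingSeq x σ n) (𝓜.codingSeq x σ (n + 1)) =
      𝓜.codingDefect x (codeWord σ (-(n + 1 : ℕ)) (n + 2)) := by
  have h_next : -((n + 1 : ℕ) : ℤ) + 1 = -n := by omega
  rw [codingSeq, codingSeq, backwardComp_eq_pathMap, backwardComp_eq_pathMap,
    codeWord_succ σ _ (n + 1), h_next, codingDefect, hσ, h_next, pathMap]

theorem IsContractive.pathExpect_codingDefect_le (ha : 𝓜.IsContractive a) {x : V → K}
    (hx : ∀ v, x v ∈ 𝓜.part v) (k : ℕ) (z : K) :
    𝓜.pathExpect (k + 1) (𝓜.codingDefect x) z ≤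
      ENNReal.ofReal a ^ k * (𝓜.lmarkovOp (𝓜.baseEDist x) z + 𝓜.baseEDist x z) := by
  obtain ⟨v, hz⟩ := 𝓜.exists_mem_part z
  have h_letter (e : E) (hz : z ∈ 𝓜.part (𝓜.i e)) :
      𝓜.pathExpect k (fun l => 𝓜.codingDefect x (e :: l)) (𝓜.w e z) ≤
        ENNReal.ofReal a ^ k * edist (𝓜.w e z) (x (𝓜.t e)) +
          ENNReal.ofReal a ^ k * edist (𝓜.w e z) (𝓜.w e (x (𝓜.i e))) :=
    calc 𝓜.pathExpect k (fun l => 𝓜.codingDefect x (e :: l)) (𝓜.w e z)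
        ≤ 𝓜.pathExpect k (fun l => edist (𝓜.pathMap l (𝓜.w e z)) (𝓜.pathMap l (x (𝓜.t e))) +
            edist (𝓜.pathMap l (𝓜.w e z)) (𝓜.pathMap l (𝓜.w e (x (𝓜.i e))))) (𝓜.w e z) :=
          𝓜.pathExpect_mono k (fun l => edist_triangle_left _ _ _) _
      _ ≤ _ := by
          rw [pathExpect_add]
          exact add_le_add (ha.pathExpect_edist_le k (𝓜.w_mapsTo e hz) (hx _))
            (ha.pathExpect_edist_le k (𝓜.w_mapsTo e hz) (𝓜.w_mapsTo e (hx _)))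
  calc 𝓜.pathExpect (k + 1) (𝓜.codingDefect x) z
      ≤ ∑ e, ENNReal.ofReal (𝓜.p e z) * (ENNReal.ofReal a ^ k * 𝓜.baseEDist x (𝓜.w e z) +
          ENNReal.ofReal a ^ k * edist (𝓜.w e z) (𝓜.w e (x v))) := by
        rw [pathExpect_succ]
        refine 𝓜.sum_ofReal_p_mul_le_sum hz ?_
        rintro e rfl
        rw [baseEDist_of_mem x (𝓜.w_mapsTo e hz)]
        exact h_letter e hz
    _ = ENNReal.ofReal a ^ k * (𝓜.lmarkovOp (𝓜.baseEDist x) z +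
          ∑ e, ENNReal.ofReal (𝓜.p e z) * edist (𝓜.w e z) (𝓜.w e (x v))) := by
        simp only [lmarkovOp, mul_add, Finset.sum_add_distrib, Finset.mul_sum, mul_left_comm]
    _ ≤ ENNReal.ofReal a ^ k * (𝓜.lmarkovOp (𝓜.baseEDist x) z + 𝓜.baseEDist x z) := by
        gcongr
        rw [baseEDist_of_mem x hz]
        exact (ha.sum_ofReal_p_mul_edist_le hz (hx v)).trans
          (mul_le_of_le_one_left zero_le ha.ofReal_lt_one.le)

theorem mem_Y_iff {x : V → K} {σ : ℤ → E} :
    σ ∈ 𝓜.Y x ↔ ∀ k : ℤ, (leftShift E ^ k) σ ∈ 𝓜.codingDomain x :=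
  mem_iInter_image_zpow _ _

theorem Y_subset_codingDomain (x : V → K) : 𝓜.Y x ⊆ 𝓜.codingDomain x :=
  fun _ hσ => mem_Y_iff.1 hσ 0

variable [OpensMeasurableSpace K] [MeasurableSpace E] [MeasurableSingletonClass E]
  {μ : Measure K} [IsFiniteMeasure μ] {M : Measure (ℤ → E)} {x : V → K}

theorem IsContractive.tsum_lintegral_codingDefect_ne_top (ha : 𝓜.IsContractive a)
    (hμ : 𝓜.IsInvariant μ) (hM : 𝓜.IsGeneralizedMarkovMeasure μ M) (hx : ∀ v, x v ∈ 𝓜.part v)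
    (m : ℕ → ℤ) :
    ∑' n, ∫⁻ σ, 𝓜.codingDefect x (codeWord σ (m n) (n + 1)) ∂M ≠ ∞ := by
  set I := ∫⁻ z, 𝓜.baseEDist x z ∂μ
  have hI : I ≠ ∞ := ha.lintegral_baseEDist_ne_top hx hμ
  have hf : Measurable (𝓜.baseEDist x) := measurable_baseEDist x
  have h_geom (n : ℕ) : ∫⁻ σ, 𝓜.codingDefect x (codeWord σ (m n) (n + 1)) ∂M ≤
      ENNReal.ofReal a ^ n * (I + I) :=
    calc ∫⁻ σ, 𝓜.codingDefect x (codeWord σ (m n) (n + 1)) ∂M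
        = ∫⁻ z, 𝓜.pathExpect (n + 1) (𝓜.codingDefect x) z ∂μ := hM.lintegral_codeWord _ _ _
      _ ≤ ∫⁻ z, ENNReal.ofReal a ^ n * (𝓜.lmarkovOp (𝓜.baseEDist x) z + 𝓜.baseEDist x z) ∂μ :=
          lintegral_mono (ha.pathExpect_codingDefect_le hx n)
      _ = ENNReal.ofReal a ^ n * (I + I) := by
          rw [lintegral_const_mul' _ _ (by finiteness), lintegral_add_right _ hf,
            hμ.lintegral_lmarkovOp hf]
  refine ne_top_of_le_ne_top ?_ (ENNReal.tsum_le_tsum h_geom)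
  rw [ENNReal.tsum_mul_right, ENNReal.tsum_geometric]
  simp [ENNReal.mul_eq_top, tsub_eq_zero_iff_le, ha.2.1, hI]

variable [CompleteSpace K]

theorem IsContractive.ae_mem_codingDomain (ha : 𝓜.IsContractive a) (hμ : 𝓜.IsInvariant μ)
    (hM : 𝓜.IsGeneralizedMarkovMeasure μ M) (hx : ∀ v, x v ∈ 𝓜.part v) :
    ∀ᵐ σ ∂M, σ ∈ 𝓜.codingDomain x := by
  let defect (n : ℕ) (σ : ℤ → E) := 𝓜.codingDefect x (codeWord σ (-(n + 1 : ℕ)) (n + 2))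
  have h_meas (n : ℕ) : Measurable (defect n) := measurable_comp_codeWord _ _ _
  have h_int : ∫⁻ σ, ∑' n, defect n σ ∂M ≠ ∞ := by
    rw [lintegral_tsum fun n => (h_meas n).aemeasurable]
    exact ne_top_of_le_ne_top
      (ha.tsum_lintegral_codingDefect_ne_top hμ hM hx fun n => -n)
      (ENNReal.tsum_comp_le_tsum_of_injective (add_left_injective 1) _)
  filter_upwards [hM.ae_mem_pathSpace, ae_lt_top (.tsum h_meas) h_int] with σ hσ h_sum
  exact ⟨hσ, cauchySeq_tendsto_of_complete <| cauchySeq_of_edist_le_of_tsum_ne_top _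
    (fun n => (edist_codingSeq_succ x hσ n).le) h_sum.ne⟩

theorem IsContractive.ae_mem_Y (ha : 𝓜.IsContractive a) (hμ : 𝓜.IsInvariant μ)
    (hM : 𝓜.IsGeneralizedMarkovMeasure μ M) (hx : ∀ v, x v ∈ 𝓜.part v) :
    ∀ᵐ σ ∂M, σ ∈ 𝓜.Y x := by
  simp only [mem_Y_iff, ae_all_iff]
  exact fun k => ae_of_ae_map (measurable_leftShift_zpow k).aemeasurable
    (ha.ae_mem_codingDomain hμ (hM.map_leftShift_zpow k) hx)

theorem IsContractive.dense_Y [TopologicalSpace E] (ha : 𝓜.IsContractive a)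
    (hp : ∀ e, ∀ z ∈ 𝓜.part (𝓜.i e), 0 < 𝓜.p e z) (hμ : 𝓜.IsInvariant μ)
    (hpos : ∀ e, 0 < μ (𝓜.part (𝓜.i e))) (hM : 𝓜.IsGeneralizedMarkovMeasure μ M)
    (hx : ∀ v, x v ∈ 𝓜.part v) : Dense {σ : 𝓜.pathSpace | (σ : ℤ → E) ∈ 𝓜.Y x} := by
  rw [dense_iff_inter_open]
  rintro _ ⟨U, hU, rfl⟩ ⟨⟨σ, hσ⟩, hσU⟩
  obtain ⟨m, k, h_sub⟩ := exists_codeCylinder_codeWord_subset hU hσU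
  have h_pos := hM.measure_codeCylinder_codeWord_pos hp hpos hσ m k
  obtain ⟨τ, hτ, hτY⟩ :=
    ((frequently_ae_mem_iff.2 h_pos.ne').and_eventually (ha.ae_mem_Y hμ hM hx)).exists
  exact ⟨⟨τ, (Y_subset_codingDomain x hτY).1⟩, h_sub hτ, hτY⟩

end Coding

end MarkovSystem

theorem lemma2_general {V E K : Type*} [Fintype E]
    [TopologicalSpace E] [MeasurableSpace E] [MeasurableSingletonClass E]
    [MetricSpace K] [CompleteSpace K] [MeasurableSpace K] [OpensMeasurableSpace K]
    (𝓜 : MarkovSystem V E K) {a : ℝ} (ha : 𝓜.IsContractive a)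
    {μ : Measure K} [IsProbabilityMeasure μ] (hμ : 𝓜.IsInvariant μ)
    {x : V → K} (hx : ∀ v, x v ∈ 𝓜.part v) :
    ((∀ σ ∈ 𝓜.Y x, ∃ y ∈ 𝓜.codingMap x σ, Tendsto (𝓜.codingSeq x σ) atTop (𝓝 y)) ∧
      𝓜.Y x ⊆ 𝓜.pathSpace ∧ leftShift E '' 𝓜.Y x = 𝓜.Y x) ∧
    𝓜.generalizedMarkovMeasure μ (𝓜.Y x) = 1 ∧
    ((∀ e, ∀ z ∈ 𝓜.part (𝓜.i e), 0 < 𝓜.p e z) →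
      (∃ ν : Measure K, IsProbabilityMeasure ν ∧ 𝓜.IsInvariant ν ∧
        ∀ e, 0 < ν (𝓜.part (𝓜.i e))) →
      Dense {σ : 𝓜.pathSpace | (σ : ℤ → E) ∈ 𝓜.Y x}) := by
  refine ⟨⟨fun σ hσ => ?_, fun σ hσ => (𝓜.Y_subset_codingDomain x hσ).1,
    image_iInter_image_zpow _ _⟩, ?_, ?_⟩
  · obtain ⟨-, h⟩ := 𝓜.Y_subset_codingDomain x hσ
    exact ⟨h.choose, ⟨h, rfl⟩, h.choose_spec⟩
  · have hM := 𝓜.isGeneralizedMarkovMeasure_generalizedMarkovMeasure hμ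
    have := hM.isProbabilityMeasure
    exact (measure_congr (eventuallyEq_univ.2 (ha.ae_mem_Y hμ hM hx))).trans measure_univ
  · rintro hp ⟨ν, _, hν, hpos⟩
    exact ha.dense_Y hp hν hpos (𝓜.isGeneralizedMarkovMeasure_generalizedMarkovMeasure hν) hx

theorem lemma2 {V E K : Type*} [Finite V] [Fintype E]
    [TopologicalSpace E] [DiscreteTopology E] [MeasurableSpace E] [BorelSpace E]
    [MetricSpace K] [MeasurableSpace K] [BorelSpace K]
    (hK : ∀ s : Set K, Bornology.IsBounded s → IsCompact (closure s))
    (𝓜 : MarkovSystem V E K)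
    (a : ℝ) (ha : 𝓜.IsContractive a)
    (hopen : ∀ v, IsOpen (𝓜.part v))
    (huc : ∀ e, UniformContinuousOn (𝓜.p e) (𝓜.part (𝓜.i e)))
    (δ : ℝ) (hδ : 0 < δ) (hpδ : ∀ e, ∀ z ∈ 𝓜.part (𝓜.i e), δ ≤ 𝓜.p e z)
    (hi : Function.Surjective 𝓜.i)
    (μ : Measure K) [IsProbabilityMeasure μ] (hμ : 𝓜.IsInvariant μ)
    (x : V → K) (hx : ∀ v, x v ∈ 𝓜.part v) :
    ((∀ σ ∈ 𝓜.Y x, ∃ y ∈ 𝓜.codingMap x σ, Tendsto (𝓜.codingSeq x σ) atTop (𝓝 y)) ∧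
      𝓜.Y x ⊆ 𝓜.pathSpace ∧ leftShift E '' 𝓜.Y x = 𝓜.Y x) ∧
    (𝓜.HasDiniProbabilities → 𝓜.generalizedMarkovMeasure μ (𝓜.Y x) = 1) ∧
    (𝓜.HasDiniProbabilities →
      (∃ ν : Measure K, IsProbabilityMeasure ν ∧ 𝓜.IsInvariant ν ∧
        ∀ e, 0 < ν (𝓜.part (𝓜.i e))) →
      Dense {σ : 𝓜.pathSpace | (σ : ℤ → E) ∈ 𝓜.Y x}) := by
  have : ProperSpace K :=
    ⟨fun z r => by simpa using hK (Metric.closedBall z r) Metric.isBounded_closedBall⟩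
  obtain ⟨h_shift, h_full, h_dense⟩ := lemma2_general 𝓜 ha hμ hx
  exact ⟨h_shift, fun _ => h_full, fun _ => h_dense fun e z hz => hδ.trans_le (hpδ e z hz)⟩
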